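/- For an integer $\ell\ge 1$ let $\mathcal B_\ell=a_1^*a_2^*\cdots a_\ell^*=\{a_1^{j_1}\cdots a_\ell^{j_\ell}\mid j_1,\dots,j_\ell\ge 0\}$ over the ordered alphabet $a_1<a_2<\cdots<a_\ell$, enumerated in increasing genealogical order (words are compared first by length, and words of equal length lexicographically). Let $\mathrm{rep}_\ell(n)$ be the $(n+1)$-st word of $\mathcal B_\ell$, let $\mathrm{val}_\ell=\mathrm{rep}_\ell^{-1}:\mathcal B_\ell\to\mathbb N$, and for $\lambda\in\mathbb N$ put $f_\lambda(w)=\mathrm{rep}_\ell(\lambda\,\mathrm{val}_\ell(w))$ for $w\in\mathcal B_\ell$. Write $|w|_{a}$ for the number of occurrences of the letter $a$ in the word $w$. Let $\ell\ge 3$ and $\beta\ge 2$ be integers such that $\frac{(\beta-1)(\ell+1)}{2}$ and $\frac{(\beta^2-1)(\ell+1)}{24}$ are both integers. Then the language $f_{\beta^\ell}(a_1^*a_\ell^*)=\{f_{\beta^\ell}(a_1^pa_\ell^q)\mid p,q\ge 0\}$ is not regular. Moreover, for fixed $\ell$ and $\beta$, with $q=p^3$ and $p\to\infty$, $$|f_{\beta^\ell}(a_1^pa_\ell^q)|_{a_1}=\beta^2p+\mathcal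 O(1),\qquad |f_{\beta^\ell}(a_1^pa_\ell^q)|_{a_2}=\frac{(\beta-1)\beta^3}{2}\,p^2+\mathcal O(p),\qquad \sum_{j=3}^{\ell}|f_{\beta^\ell}(a_1^pa_\ell^q)|_{a_j}=\beta q+\mathcal O(p^2).$$ -/

import Mathlib

open Filter Asymptotics

/-- The bounded language `a₁* a₂* ⋯ a_ℓ*` over the alphabet `a₁ < a₂ < ⋯ < a_ℓ`,
where the letter `a_{i+1}` is `i : Fin ℓ`. -/
def boundedLang (ℓ : ℕ) : Language (Fin ℓ) :=
  {w | ∃ j : Fin ℓ → ℕ, w = (List.ofFn fun i => List.replicate (j i) i).flatten}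

/-- The strict genealogical (radix, shortlex) order on the words over `a₁ < ⋯ < a_ℓ`. -/
def GenLT {ℓ : ℕ} (x y : List (Fin ℓ)) : Prop :=
  List.Shortlex (· < ·) x y

/-- The numerical value of a word of the bounded language: the number of words of the bounded
language that are genealogically less. (The `(n+1)`-st word has value `n`.) -/
noncomputable def valB (ℓ : ℕ) (w : List (Fin ℓ)) : ℕ :=
  {v : List (Fin ℓ) | v ∈ boundedLang ℓ ∧ GenLT v w}.ncard

/-- The representation of `n`: the word of the bounded language with value `n`. For `ℓ ≥ 1` there
is exactly one such word, see `valB_bijOn`. -/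
noncomputable def repB (ℓ n : ℕ) : List (Fin ℓ) :=
  Function.invFunOn (valB ℓ) {w | w ∈ boundedLang ℓ} n

/-- Multiplication by `m`, transported to the bounded language. -/
noncomputable def mulMap (ℓ m : ℕ) (w : List (Fin ℓ)) : List (Fin ℓ) :=
  repB ℓ (m * valB ℓ w)

/-- The language `f(L)`, the direct image of the language `L` under the map `f` on words. -/
def imageLang {α : Type*} (f : List α → List α) (L : Language α) : Language α :=
  {w | ∃ v ∈ L, f v = w}

/-- The language `a* b*`. -/
def starStar {α : Type*} (a b : α) : Language α :=
  {w | ∃ p q : ℕ, w = List.replicate p a ++ List.replicate q b}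

theorem genLT_finite {ℓ : ℕ} (w : List (Fin ℓ)) :
    {v : List (Fin ℓ) | v ∈ boundedLang ℓ ∧ GenLT v w}.Finite := by
  refine (List.finite_length_le (Fin ℓ) w.length).subset ?_
  rintro v ⟨-, hv⟩
  rcases List.shortlex_def.mp hv with h | h
  · exact h.le
  · exact h.1.le

theorem GenLT.trans' {ℓ : ℕ} {x y z : List (Fin ℓ)} (h : GenLT x y) (h' : GenLT y z) :
    GenLT x z := by
  rcases List.shortlex_def.mp h with h | ⟨h, hl⟩ <;>
  rcases List.shortlex_def.mp h' with h' | ⟨h', hl'⟩ <;> apply List.shortlex_def.mpr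
  · left; omega
  · left; omega
  · left; omega
  · right
    refine ⟨h.trans h', ?_⟩
    have a : x < y := hl
    have b : y < z := hl'
    exact lt_trans a b

theorem not_genLT_self {ℓ : ℕ} (x : List (Fin ℓ)) : ¬ GenLT x x := by
  intro h
  rcases List.shortlex_def.mp h with h | ⟨_, hl⟩
  · omega
  · have a : x < x := hl
    exact lt_irrefl _ a

theorem genLT_trichotomy {ℓ : ℕ} (x y : List (Fin ℓ)) : GenLT x y ∨ x = y ∨ GenLT y x := by
  rcases lt_trichotomy x.length y.length with h | h | h
  · exact Or.inl (List.Shortlex.of_length_lt h)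
  · rcases lt_trichotomy x y with h' | h' | h'
    · exact Or.inl (List.Shortlex.of_lex h h')
    · exact Or.inr (Or.inl h')
    · exact Or.inr (Or.inr (List.Shortlex.of_lex h.symm h'))
  · exact Or.inr (Or.inr (List.Shortlex.of_length_lt h))

theorem valB_lt {ℓ : ℕ} {x y : List (Fin ℓ)} (hx : x ∈ boundedLang ℓ) (h : GenLT x y) :
    valB ℓ x < valB ℓ y := by
  apply Set.ncard_lt_ncard _ (genLT_finite y)
  refine ⟨fun v hv => ⟨hv.1, hv.2.trans' h⟩, fun hs => ?_⟩
  exact not_genLT_self x (hs (show x ∈ {v | _} from ⟨hx, h⟩)).2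

theorem valB_injOn (ℓ : ℕ) : Set.InjOn (valB ℓ) {w | w ∈ boundedLang ℓ} := by
  intro x hx y hy h
  rcases genLT_trichotomy x y with h' | h' | h'
  · exact absurd h (valB_lt hx h').ne
  · exact h'
  · exact absurd h (valB_lt hy h').ne'

/-- For `ℓ ≥ 1` the numerical value is a one-to-one correspondence between the bounded language
and the nonnegative integers, so that `repB` is well defined. -/
theorem valB_bijOn {ℓ : ℕ} (hℓ : 1 ≤ ℓ) :
    Set.BijOn (valB ℓ) {w | w ∈ boundedLang ℓ} Set.univ := by
  refine ⟨fun _ _ => trivial, valB_injOn ℓ, ?_⟩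
  have hinf : {w : List (Fin ℓ) | w ∈ boundedLang ℓ}.Infinite := by
    have hinj : Function.Injective fun n : ℕ =>
        (List.ofFn fun i : Fin ℓ => List.replicate ((fun _ => n : Fin ℓ → ℕ) i) i).flatten := by
      intro m n h
      have h2 := congrArg List.length h
      simp [List.length_flatten, List.map_ofFn, Function.comp_def] at h2
      omega
    refine (Set.infinite_range_of_injective hinj).mono ?_
    rintro _ ⟨n, rfl⟩
    exact ⟨fun _ => n, rfl⟩
  -- every value attained has its predecessor attained
  have hpred : ∀ n, ∀ w ∈ boundedLang ℓ, valB ℓ w = n + 1 →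
      ∃ v ∈ boundedLang ℓ, valB ℓ v = n := by
    intro n w hw hn
    have hne : {v : List (Fin ℓ) | v ∈ boundedLang ℓ ∧ GenLT v w}.Nonempty := by
      rw [Set.nonempty_iff_ne_empty]
      intro h
      simp [valB, h] at hn
    obtain ⟨v, hv, hmax⟩ := Set.exists_max_image _ (valB ℓ) (genLT_finite w) hne
    refine ⟨v, hv.1, ?_⟩
    have hins : {u : List (Fin ℓ) | u ∈ boundedLang ℓ ∧ GenLT u w} =
        insert v {u : List (Fin ℓ) | u ∈ boundedLang ℓ ∧ GenLT u v} := by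
      ext u
      constructor
      · intro hu
        rcases genLT_trichotomy u v with h | h | h
        · exact Or.inr ⟨hu.1, h⟩
        · exact Or.inl h
        · exact absurd (hmax u hu) (not_le.mpr (valB_lt hv.1 h))
      · rintro (rfl | hu)
        · exact hv
        · exact ⟨hu.1, hu.2.trans' hv.2⟩
    have : valB ℓ w = valB ℓ v + 1 := by
      unfold valB
      rw [hins, Set.ncard_insert_of_notMem _ (genLT_finite v)]
      exact fun h => not_genLT_self v h.2
    omega
  have hdown : ∀ k n, (∃ w ∈ boundedLang ℓ, valB ℓ w = n + k) →
      ∃ v ∈ boundedLang ℓ, valB ℓ v = n := by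
    intro k
    induction k with
    | zero => intro n h; exact h
    | succ k ih =>
      rintro n ⟨w, hw, h⟩
      exact ih n (hpred _ w hw h)
  intro n _
  obtain ⟨_, ⟨w, hw, rfl⟩, hm⟩ := (hinf.image (valB_injOn ℓ)).exists_gt n
  obtain ⟨v, hv, hvn⟩ := hdown (valB ℓ w - n) n ⟨w, hw, by omega⟩
  exact ⟨v, hv, hvn⟩

/-! On bounded words the value is a combinatorial number: `Nat.multichoose s k` counts the words of
length less than `s` over `k` ordered letters, so the value is the sum of these counts over the
suffix lengths `s` obtained by deleting leading letters (`valB_expWord`). These digits are greedy,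
hence unique (`multichoose_unique`), and exponents are differences of consecutive digits.

Put `ℓ = n + 2`, `q = p ^ 3` and expand `β ^ ℓ` times the value of `a₁^p a_ℓ^q` in powers of `1 /
p`. The first digit is `βp³ + βp + d` and the second is `βp³ - β(β - 1)p + d - e`, where `d` and `e`
are the two numbers assumed integral. What remains is `(βp³)^n / n!` times `1 - (nc/β)/p + O(1/p²)`
with `c = (β - 1)β³/2` (`remainder_eq`), which forces the third digit to be `βp³ - cp² + O(p)`
(`exists_bounds`). Differences of the digits give the three estimates (`exists_exponents`).

Nonregularity is a growth argument. Multiplication does not shorten words, so the image has at most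
quadratically many words of bounded length. The estimates yield words with three arbitrarily long
blocks; in a regular language these could be pumped independently, giving cubic growth
(`Language.IsRegular.exists_cube_le`). -/

/-! ### Exponent vectors and the combinatorial number system. -/

/-- The word `a₁^{j a₁} a₂^{j a₂} ⋯` over the list `a₁, a₂, …` of letters. -/
def expWord {α : Type*} (as : List α) (j : α → ℕ) : List α :=
  as.flatMap fun a => List.replicate (j a) a

/-- The combinatorial number with the suffix lengths of `expWord as j` as its digits. -/
def expVal {α : Type*} : List α → (α → ℕ) → ℕ
  | [], _ => 0
  | a :: as, j =>
    Nat.multichoose (j a + (as.map j).sum) (as.length + 1) + expVal as j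

theorem multichoose_mono (k : ℕ) : Monotone fun n => Nat.multichoose n k := by
  refine monotone_nat_of_le_succ fun n => ?_
  cases k with
  | zero => simp
  | succ k => simp only [Nat.multichoose_succ_succ]; omega

section
variable {α : Type*}

@[simp] theorem expWord_nil (j : α → ℕ) : expWord [] j = [] := rfl

@[simp] theorem expWord_cons (a : α) (as : List α) (j : α → ℕ) :
    expWord (a :: as) j = List.replicate (j a) a ++ expWord as j := by
  simp [expWord]

@[simp] theorem length_expWord (as : List α) (j : α → ℕ) :
    (expWord as j).length = (as.map j).sum := by
  induction as with
  | nil => rfl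
  | cons a as ih => simp [ih]

theorem mem_of_mem_expWord {as : List α} {j : α → ℕ} {x : α} (h : x ∈ expWord as j) :
    x ∈ as := by
  simp only [expWord, List.mem_flatMap, List.mem_replicate] at h
  obtain ⟨a, ha, -, rfl⟩ := h
  exact ha

theorem expWord_congr {as : List α} {j j' : α → ℕ} (h : ∀ a ∈ as, j a = j' a) :
    expWord as j = expWord as j' := by
  induction as with
  | nil => rfl
  | cons a as ih =>
    simp [h a (by simp), ih fun b hb => h b (by simp [hb])]

theorem expVal_congr {as : List α} {j j' : α → ℕ} (h : ∀ a ∈ as, j a = j' a) :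
    expVal as j = expVal as j' := by
  induction as with
  | nil => rfl
  | cons a as ih =>
    have h' : as.map j = as.map j' := List.map_congr_left fun b hb => h b (by simp [hb])
    simp [expVal, h a (by simp), ih fun b hb => h b (by simp [hb]), h']

theorem count_expWord [DecidableEq α] {as : List α} (has : as.Nodup) (j : α → ℕ) {a : α}
    (ha : a ∈ as) : (expWord as j).count a = j a := by
  induction as with
  | nil => simp at ha
  | cons b as ih =>
    rw [List.nodup_cons] at has
    rcases List.mem_cons.mp ha with rfl | h
    · simp [List.count_eq_zero.mpr fun h => has.1 (mem_of_mem_expWord h)]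
    · have hne : b ≠ a := fun h' => has.1 (h' ▸ h)
      simp [ih has.2 h, List.count_replicate, hne]

/-- Pascal's rule, one letter at a time: the tail contributes less than the gap between consecutive
values of the leading term. This makes the digits greedy. -/
theorem expVal_lt (as : List α) (j : α → ℕ) :
    expVal as j < Nat.multichoose ((as.map j).sum + 1) as.length := by
  induction as with
  | nil => simp [expVal]
  | cons a as ih =>
    simp only [expVal, List.map_cons, List.sum_cons, List.length_cons, Nat.multichoose_succ_succ]
    have := multichoose_mono as.length
      (show (as.map j).sum + 1 ≤ j a + (as.map j).sum + 1 by omega)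
    simp only at this
    omega

theorem le_expVal (as : List α) (j : α → ℕ) (h : as ≠ []) :
    Nat.multichoose (as.map j).sum as.length ≤ expVal as j := by
  cases as with
  | nil => simp at h
  | cons a as => simp [expVal]

theorem expVal_lt_of_sum_lt {as : List α} {j j' : α → ℕ}
    (h : (as.map j).sum < (as.map j').sum) : expVal as j < expVal as j' := by
  have hne : as ≠ [] := by rintro rfl; simp at h
  exact (expVal_lt as j).trans_le ((multichoose_mono _ h).trans (le_expVal as j' hne))

/-- Greedy expansion: take the largest `T` whose leading term is at most `R`. By Pascal's rule the
rest is small enough for a tail of total length at most `T`, and the first exponent makes up the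
difference. -/
theorem exists_expVal_eq {as : List α} (has : as.Nodup) :
    ∀ {S R : ℕ}, R < Nat.multichoose (S + 1) as.length →
      ∃ j : α → ℕ, (as.map j).sum ≤ S ∧ expVal as j = R := by
  classical
  induction as with
  | nil =>
    intro S R h
    exact ⟨0, by simp, by simp at h; simp [expVal, h]⟩
  | cons a as ih =>
    rw [List.nodup_cons] at has
    intro S R hR
    simp only [List.length_cons] at hR
    obtain ⟨T, hTS, hT, hT'⟩ : ∃ T ≤ S, Nat.multichoose T (as.length + 1) ≤ R ∧
        R < Nat.multichoose (T + 1) (as.length + 1) := by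
      clear ih
      induction S with
      | zero => exact ⟨0, le_rfl, by simp, hR⟩
      | succ S ih =>
        by_cases h : R < Nat.multichoose (S + 1) (as.length + 1)
        · obtain ⟨T, h1, h2⟩ := ih h
          exact ⟨T, by omega, h2⟩
        · exact ⟨S + 1, le_rfl, by omega, hR⟩
    rw [Nat.multichoose_succ_succ] at hT'
    obtain ⟨j, hj, hj'⟩ := ih has.2 (S := T)
      (R := R - Nat.multichoose T (as.length + 1)) (by omega)
    have hne : ∀ b ∈ as, Function.update j a (T - (as.map j).sum) b = j b := by
      intro b hb
      exact Function.update_of_ne (by rintro rfl; exact has.1 hb) _ _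
    refine ⟨Function.update j a (T - (as.map j).sum), ?_, ?_⟩
    · simp only [List.map_cons, List.sum_cons, Function.update_self, List.map_congr_left hne]
      omega
    · simp only [expVal, Function.update_self, List.map_congr_left hne, expVal_congr hne, hj',
        Nat.sub_add_cancel hj]
      omega

theorem lt_of_append_lt_append_left [LinearOrder α] (x : List α) {y z : List α}
    (h : x ++ y < x ++ z) : y < z := by
  induction x with
  | nil => exact h
  | cons a x ih =>
    refine ih ?_
    simpa [List.cons_lt_cons_iff] using h

/-- At equal length, a longer initial block of the least letter makes a word smaller, and it also
leaves a shorter tail, hence a smaller next digit. -/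
theorem expVal_lt_of_lex [LinearOrder α] {as : List α} (has : as.Pairwise (· < ·))
    {j j' : α → ℕ} (hs : (as.map j).sum = (as.map j').sum)
    (h : expWord as j < expWord as j') : expVal as j < expVal as j' := by
  induction as with
  | nil => simp at h
  | cons a as ih =>
    rw [List.pairwise_cons] at has
    simp only [List.map_cons, List.sum_cons] at hs
    simp only [expVal, hs, add_lt_add_iff_left]
    rcases lt_trichotomy (j a) (j' a) with hlt | heq | hgt
    -- After cancelling the common `a`s, the left word continues with a letter above `a` (its tail
    -- is nonempty, the lengths being equal) while the right one still has an `a`.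
    · exfalso
      obtain ⟨d, hd⟩ := Nat.exists_eq_add_of_lt hlt
      rw [expWord_cons, expWord_cons, hd, add_assoc, List.replicate_add, List.append_assoc] at h
      have h2 := lt_of_append_lt_append_left _ h
      rw [List.replicate_succ, List.cons_append] at h2
      have hlen : (expWord as j).length ≠ 0 := by rw [length_expWord]; omega
      cases hw : expWord as j with
      | nil => simp [hw] at hlen
      | cons b w =>
        have hb : a < b := has.1 b (mem_of_mem_expWord (j := j) (by simp [hw]))
        rw [hw, List.cons_lt_cons_iff] at h2
        rcases h2 with h2 | h2
        · exact lt_asymm hb h2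
        · exact hb.ne' h2.1
    · refine ih has.2 (by omega) ?_
      rw [expWord_cons, expWord_cons, heq] at h
      exact lt_of_append_lt_append_left _ h
    · exact expVal_lt_of_sum_lt (by omega)

end

/-! ### The numerical value as a combinatorial number. -/

theorem mem_boundedLang_iff {ℓ : ℕ} {w : List (Fin ℓ)} :
    w ∈ boundedLang ℓ ↔ ∃ j : Fin ℓ → ℕ, w = expWord (List.finRange ℓ) j := by
  simp only [expWord, List.flatMap_def, ← List.ofFn_eq_map]
  rfl

theorem expVal_lt_of_genLT {ℓ : ℕ} {j j' : Fin ℓ → ℕ}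
    (h : GenLT (expWord (List.finRange ℓ) j) (expWord (List.finRange ℓ) j')) :
    expVal (List.finRange ℓ) j < expVal (List.finRange ℓ) j' := by
  rcases List.shortlex_def.mp h with h | ⟨h, h'⟩
  · exact expVal_lt_of_sum_lt (by simpa only [length_expWord] using h)
  · exact expVal_lt_of_lex (List.pairwise_lt_finRange ℓ) (by simpa only [length_expWord] using h) h'

theorem expWord_injective (ℓ : ℕ) : Function.Injective (expWord (List.finRange ℓ)) := by
  intro i j h
  funext a
  rw [← count_expWord (List.nodup_finRange ℓ) i (List.mem_finRange a), h,
    count_expWord (List.nodup_finRange ℓ) j (List.mem_finRange a)]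

theorem genLT_iff_expVal_lt {ℓ : ℕ} {i j : Fin ℓ → ℕ} :
    GenLT (expWord (List.finRange ℓ) i) (expWord (List.finRange ℓ) j) ↔
      expVal (List.finRange ℓ) i < expVal (List.finRange ℓ) j := by
  refine ⟨expVal_lt_of_genLT, fun h => ?_⟩
  rcases genLT_trichotomy (expWord (List.finRange ℓ) i) (expWord (List.finRange ℓ) j) with
    h' | h' | h'
  · exact h'
  · rw [expWord_injective ℓ h'] at h
    exact absurd h (lt_irrefl _)
  · exact absurd h (expVal_lt_of_genLT h').not_gt

theorem expVal_injective (ℓ : ℕ) : Function.Injective (expVal (List.finRange ℓ)) := by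
  intro i j h
  rcases genLT_trichotomy (expWord (List.finRange ℓ) i) (expWord (List.finRange ℓ) j) with
    h' | h' | h'
  · exact absurd h (expVal_lt_of_genLT h').ne
  · exact expWord_injective ℓ h'
  · exact absurd h (expVal_lt_of_genLT h').ne'

/-- `expVal` respects the genealogical order and takes every natural number as a value, so the
predecessors of a word correspond to the numbers below its `expVal`. -/
theorem valB_expWord {ℓ : ℕ} (j : Fin ℓ → ℕ) :
    valB ℓ (expWord (List.finRange ℓ) j) = expVal (List.finRange ℓ) j := by
  have hw : {v | v ∈ boundedLang ℓ ∧ GenLT v (expWord (List.finRange ℓ) j)} =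
      expWord (List.finRange ℓ) '' {i | expVal (List.finRange ℓ) i <
        expVal (List.finRange ℓ) j} := by
    ext v
    constructor
    · rintro ⟨hv, hlt⟩
      obtain ⟨i, rfl⟩ := mem_boundedLang_iff.mp hv
      exact ⟨i, genLT_iff_expVal_lt.mp hlt, rfl⟩
    · rintro ⟨i, hi, rfl⟩
      exact ⟨mem_boundedLang_iff.mpr ⟨i, rfl⟩, genLT_iff_expVal_lt.mpr hi⟩
  have hv : Set.Iio (expVal (List.finRange ℓ) j) =
      expVal (List.finRange ℓ) '' {i | expVal (List.finRange ℓ) i <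
        expVal (List.finRange ℓ) j} := by
    ext n
    constructor
    · intro hn
      have hn' : n < expVal (List.finRange ℓ) j := hn
      obtain ⟨i, -, hi⟩ := exists_expVal_eq (List.nodup_finRange ℓ)
        (hn'.trans (expVal_lt (List.finRange ℓ) j))
      exact ⟨i, by simpa [hi] using hn', hi⟩
    · rintro ⟨i, hi, rfl⟩
      exact hi
  rw [valB, hw, Set.ncard_image_of_injective _ (expWord_injective ℓ),
    ← Set.ncard_image_of_injective _ (expVal_injective ℓ), ← hv]
  simp [Set.ncard_eq_toFinset_card']

theorem repB_spec {ℓ : ℕ} (hℓ : 1 ≤ ℓ) (n : ℕ) :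
    repB ℓ n ∈ boundedLang ℓ ∧ valB ℓ (repB ℓ n) = n := by
  obtain ⟨w, hw, rfl⟩ := (valB_bijOn hℓ).surjOn (Set.mem_univ n)
  exact ⟨Function.invFunOn_mem ⟨w, hw, rfl⟩, Function.invFunOn_eq ⟨w, hw, rfl⟩⟩

/-- The word `mulMap ℓ m w` is determined by its value. -/
theorem exists_mulMap_eq {ℓ : ℕ} (hℓ : 1 ≤ ℓ) (m : ℕ) (w : List (Fin ℓ)) :
    ∃ j : Fin ℓ → ℕ, mulMap ℓ m w = expWord (List.finRange ℓ) j ∧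
      expVal (List.finRange ℓ) j = m * valB ℓ w := by
  obtain ⟨h, h'⟩ := repB_spec hℓ (m * valB ℓ w)
  obtain ⟨j, hj⟩ := mem_boundedLang_iff.mp h
  exact ⟨j, hj, by rw [← valB_expWord, ← hj, h']⟩

theorem length_le_length_mulMap {ℓ m : ℕ} (hℓ : 1 ≤ ℓ) (hm : 1 ≤ m) (w : List (Fin ℓ)) :
    w.length ≤ (mulMap ℓ m w).length := by
  by_contra! h
  obtain ⟨h1, h2⟩ := repB_spec hℓ (m * valB ℓ w)
  have h3 := valB_lt h1 (List.Shortlex.of_length_lt h : GenLT _ w)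
  rw [h2] at h3
  exact absurd h3 (Nat.le_mul_of_pos_left _ hm).not_gt

/-- The letters `a₁ < a₂ < ⋯ < a_ℓ` with the first and the last ones split off. -/
theorem finRange_eq_cons_concat (n : ℕ) :
    ∃ mid : List (Fin (n + 2)), mid.length = n ∧
      List.finRange (n + 2) = 0 :: (mid ++ [Fin.last (n + 1)]) := by
  refine ⟨((List.finRange n).map Fin.castSucc).map Fin.succ, by simp, ?_⟩
  rw [List.finRange_succ, List.finRange_succ_last]
  simp

theorem expWord_eq_nil {α : Type*} {as : List α} {j : α → ℕ} (h : ∀ a ∈ as, j a = 0) :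
    expWord as j = [] := by
  rw [expWord, List.flatMap_eq_nil_iff]
  intro a ha
  simp [h a ha]

theorem expWord_append {α : Type*} (as bs : List α) (j : α → ℕ) :
    expWord (as ++ bs) j = expWord as j ++ expWord bs j := by
  simp [expWord]

/-- All suffix lengths equal `j z`, so Pascal's rule telescopes the sum; the `+ 1` supplies the
missing term of index `0`. -/
theorem expVal_concat {α : Type*} {as : List α} {j : α → ℕ} (h : ∀ a ∈ as, j a = 0) (z : α) :
    expVal (as ++ [z]) j + 1 = Nat.multichoose (j z + 1) (as.length + 1) := by
  induction as with
  | nil => simp [expVal]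
  | cons a as ih =>
    have h' : ∀ b ∈ as, j b = 0 := fun b hb => h b (by simp [hb])
    have hs : (as.map j).sum = 0 := by
      rw [← length_expWord, expWord_eq_nil h', List.length_nil]
    have hs' : ((as ++ [z]).map j).sum = j z := by simp [hs]
    simp only [List.cons_append, expVal, h a (by simp), hs', List.length_append, zero_add,
      List.length_cons, List.length_nil, add_assoc, ih h']
    exact (Nat.multichoose_succ_succ (j z) (as.length + 1)).symm

/-- The word `a₁^p a_ℓ^q`, for `ℓ = n + 2`, and its value. -/
theorem exists_expWord_eq_starStar (n p q : ℕ) :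
    ∃ j : Fin (n + 2) → ℕ, List.replicate p 0 ++ List.replicate q (Fin.last (n + 1)) =
      expWord (List.finRange (n + 2)) j ∧ expVal (List.finRange (n + 2)) j + 1 =
        Nat.multichoose (p + q) (n + 2) + Nat.multichoose (q + 1) (n + 1) := by
  obtain ⟨mid, hlen, hfin⟩ := finRange_eq_cons_concat n
  have hnd := List.nodup_finRange (n + 2)
  rw [hfin] at hnd
  have hne : (0 : Fin (n + 2)) ≠ Fin.last (n + 1) := by simp [Fin.ext_iff]
  set j : Fin (n + 2) → ℕ := fun i => if i = 0 then p else if i = Fin.last (n + 1) then q else 0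
    with hj
  have h0 : j 0 = p := by simp [hj]
  have hl : j (Fin.last (n + 1)) = q := by simp [hj, hne.symm]
  have hmid : ∀ a ∈ mid, j a = 0 := by
    intro a ha
    have h1 : a ≠ 0 := by rintro rfl; simp [ha] at hnd
    have h2 : a ≠ Fin.last (n + 1) := by
      rintro rfl
      simp only [List.nodup_cons, List.nodup_append] at hnd
      exact hnd.2.2.2 _ ha _ (by simp) rfl
    simp [hj, h1, h2]
  have hs : (mid.map j).sum = 0 := by
    rw [← length_expWord, expWord_eq_nil hmid, List.length_nil]
  refine ⟨j, ?_, ?_⟩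
  · rw [hfin, expWord_cons, expWord_append, expWord_eq_nil hmid]
    simp [h0, hl]
  · have := expVal_concat hmid (Fin.last (n + 1))
    rw [hfin]
    simp only [expVal, add_assoc, this]
    simp [hs, h0, hl, hlen]

/-! ### Pumping blocks and the growth of regular languages. -/

theorem Function.exists_iterate_add_eq_iterate {σ : Type*} [Fintype σ] (g : σ → σ) (s : σ) :
    ∃ k, 0 < k ∧ k ≤ Fintype.card σ ∧ ∀ j, Fintype.card σ ≤ j → g^[j + k] s = g^[j] s := by
  obtain ⟨x, y, hxy, h⟩ := Fintype.exists_ne_map_eq_of_card_lt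
    (fun i : Fin (Fintype.card σ + 1) => g^[i] s) (by simp)
  wlog hlt : x < y generalizing x y
  · exact this y x hxy.symm h.symm (lt_of_le_of_ne (not_lt.mp hlt) hxy.symm)
  have hlt' : (x : ℕ) < y := hlt
  have hy := y.isLt
  refine ⟨y - x, by omega, by omega, fun j hj => ?_⟩
  have e1 : j + (y - x) = (j - x) + y := by omega
  have e2 : j = (j - x) + x := by omega
  rw [e1, Function.iterate_add_apply, ← h, ← Function.iterate_add_apply, ← e2]

theorem DFA.evalFrom_replicate {α σ : Type*} (M : DFA α σ) (s : σ) (a : α) (n : ℕ) :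
    M.evalFrom s (List.replicate n a) = (fun t => M.step t a)^[n] s := by
  induction n generalizing s with
  | zero => rfl
  | succ n ih => rw [List.replicate_succ, DFA.evalFrom_cons, ih, Function.iterate_succ_apply]

/-- A long block of equal letters in a word of a regular language can be pumped, with a bounded
period. -/
theorem Language.IsRegular.exists_pump_replicate {α : Type*} {L : Language α} (hL : L.IsRegular) :
    ∃ N : ℕ, ∀ (x y : List α) (a : α) (j : ℕ), N ≤ j → x ++ (List.replicate j a ++ y) ∈ L →
      ∃ k, 0 < k ∧ k ≤ N ∧ ∀ t, x ++ (List.replicate (j + t * k) a ++ y) ∈ L := by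
  obtain ⟨σ, _, M, rfl⟩ := hL
  refine ⟨Fintype.card σ, fun x y a j hj h => ?_⟩
  obtain ⟨k, h0, hk, hp⟩ := Function.exists_iterate_add_eq_iterate (fun t => M.step t a)
    (M.evalFrom M.start x)
  refine ⟨k, h0, hk, fun t => ?_⟩
  have ht : ∀ t, (fun t => M.step t a)^[j + t * k] (M.evalFrom M.start x) =
      (fun t => M.step t a)^[j] (M.evalFrom M.start x) := by
    intro t
    induction t with
    | zero => simp
    | succ t ih => rw [Nat.succ_mul, ← add_assoc, hp _ (by omega), ih]
  rw [DFA.mem_accepts, DFA.eval, DFA.evalFrom_of_append, DFA.evalFrom_of_append,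
    DFA.evalFrom_replicate] at h ⊢
  rwa [ht]

theorem expWord_split {α : Type*} [DecidableEq α] {as : List α} (has : as.Nodup)
    {a : α} (ha : a ∈ as) (j : α → ℕ) :
    ∃ x y : List α, ∀ n, expWord as (Function.update j a n) = x ++ (List.replicate n a ++ y) := by
  obtain ⟨s, t, rfl⟩ := List.append_of_mem ha
  have hs : ∀ b ∈ s, b ≠ a := by
    rintro b hb rfl
    exact (List.nodup_append.mp has).2.2 b hb b (by simp) rfl
  have ht : ∀ b ∈ t, b ≠ a := by
    rintro b hb rfl
    exact (List.nodup_cons.mp (List.nodup_append.mp has).2.1).1 hb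
  refine ⟨expWord s j, expWord t j, fun n => ?_⟩
  rw [expWord_append, expWord_cons, Function.update_self,
    expWord_congr fun b hb => Function.update_of_ne (hs b hb) n j,
    expWord_congr fun b hb => Function.update_of_ne (ht b hb) n j]

theorem sum_map_update_add {α : Type*} [DecidableEq α] {as : List α} (has : as.Nodup)
    {a : α} (ha : a ∈ as) (j : α → ℕ) (m : ℕ) :
    (as.map (Function.update j a (j a + m))).sum = (as.map j).sum + m := by
  obtain ⟨x, y, hxy⟩ := expWord_split has ha j
  have h := hxy (j a)
  rw [Function.update_eq_self] at h
  rw [← length_expWord, ← length_expWord, hxy, h]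
  simp only [List.length_append, List.length_replicate]
  omega

theorem Language.IsRegular.exists_pump_expWord {α : Type*} [DecidableEq α] {L : Language α}
    (hL : L.IsRegular) {as : List α} (has : as.Nodup) :
    ∃ N K : ℕ, 0 < K ∧ ∀ (j : α → ℕ) (a : α), a ∈ as → N ≤ j a → expWord as j ∈ L →
      ∀ t, expWord as (Function.update j a (j a + t * K)) ∈ L := by
  obtain ⟨N, hN⟩ := hL.exists_pump_replicate
  -- The period depends on the block but is at most `N`, so `N!` is a common multiple that serves
  -- every block.
  refine ⟨N, N.factorial, N.factorial_pos, fun j a ha hj h t => ?_⟩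
  obtain ⟨x, y, hxy⟩ := expWord_split has ha j
  have h' := hxy (j a)
  rw [Function.update_eq_self] at h'
  rw [h'] at h
  obtain ⟨k, h0, hk, ht⟩ := hN x y a (j a) hj h
  obtain ⟨c, hc⟩ := Nat.dvd_factorial h0 hk
  rw [hxy, hc, show t * (k * c) = t * c * k by ring]
  exact ht _

/-- A regular language with a word in which three letters have long blocks has at least cubic
growth. -/
theorem Language.IsRegular.exists_cube_le {α : Type*} [Fintype α] [DecidableEq α] {L : Language α}
    (hL : L.IsRegular) {as : List α} (has : as.Nodup) :
    ∃ N K : ℕ, ∀ (j : α → ℕ) (a b c : α), a ∈ as → b ∈ as → c ∈ as → a ≠ b → a ≠ c → b ≠ c →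
      N ≤ j a → N ≤ j b → N ≤ j c → expWord as j ∈ L →
      ∀ n, n ^ 3 ≤ {w | w ∈ L ∧ w.length ≤ (as.map j).sum + 3 * (n * K)}.ncard := by
  obtain ⟨N, K, hK, hN⟩ := hL.exists_pump_expWord has
  refine ⟨N, K, fun j a b c ha hb hc hab hac hbc hja hjb hjc h n => ?_⟩
  set J : ℕ × ℕ × ℕ → α → ℕ := fun t => Function.update (Function.update
    (Function.update j a (j a + t.1 * K)) b (j b + t.2.1 * K)) c (j c + t.2.2 * K) with hJ
  have hJa : ∀ t, J t a = j a + t.1 * K := fun t => by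
    simp [hJ, Function.update_of_ne hac, Function.update_of_ne hab]
  have hJb : ∀ t, J t b = j b + t.2.1 * K := fun t => by
    simp [hJ, Function.update_of_ne hbc]
  have hJc : ∀ t, J t c = j c + t.2.2 * K := fun t => by simp [hJ]
  have hmem : ∀ t, expWord as (J t) ∈ L ∧
      (as.map (J t)).sum = (as.map j).sum + t.1 * K + t.2.1 * K + t.2.2 * K := by
    intro t
    have h1 := hN j a ha hja h t.1
    have s1 := sum_map_update_add has ha j (t.1 * K)
    set j1 := Function.update j a (j a + t.1 * K) with hj1
    have e1 : j1 b = j b := Function.update_of_ne hab.symm _ _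
    have h2 := hN j1 b hb (by omega) h1 t.2.1
    have s2 := sum_map_update_add has hb j1 (t.2.1 * K)
    rw [e1] at h2 s2
    set j2 := Function.update j1 b (j b + t.2.1 * K) with hj2
    have e2 : j2 c = j c := by
      rw [hj2, Function.update_of_ne hbc.symm, hj1, Function.update_of_ne hac.symm]
    have h3 := hN j2 c hc (by omega) h2 t.2.2
    have s3 := sum_map_update_add has hc j2 (t.2.2 * K)
    rw [e2] at h3 s3
    exact ⟨h3, by rw [hJ, ← s1, ← s2, ← s3]⟩
  have hinj : Function.Injective fun t => expWord as (J t) := by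
    intro t t' htt
    have hcount : ∀ x ∈ as, J t x = J t' x := fun x hx => by
      rw [← count_expWord has (J t) hx, ← count_expWord has (J t') hx]
      exact congrArg (List.count x) htt
    have h1 := hcount a ha
    have h2 := hcount b hb
    have h3 := hcount c hc
    rw [hJa, hJa, add_right_inj] at h1
    rw [hJb, hJb, add_right_inj] at h2
    rw [hJc, hJc, add_right_inj] at h3
    exact Prod.ext (Nat.eq_of_mul_eq_mul_right hK h1)
      (Prod.ext (Nat.eq_of_mul_eq_mul_right hK h2) (Nat.eq_of_mul_eq_mul_right hK h3))
  set T : Finset (ℕ × ℕ × ℕ) := Finset.range n ×ˢ Finset.range n ×ˢ Finset.range n with hT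
  have hcard : ((fun t => expWord as (J t)) '' (T : Set (ℕ × ℕ × ℕ))).ncard = n ^ 3 := by
    rw [Set.ncard_image_of_injective _ hinj, Set.ncard_coe_finset, hT]
    simp only [Finset.card_product, Finset.card_range]
    ring
  rw [← hcard]
  refine Set.ncard_le_ncard ?_ ((List.finite_length_le α _).subset fun w hw => hw.2)
  rintro _ ⟨t, ht, rfl⟩
  refine ⟨(hmem t).1, ?_⟩
  simp only [hT, Finset.coe_product, Set.mem_prod, Finset.mem_coe, Finset.mem_range] at ht
  rw [length_expWord, (hmem t).2]
  have h1 := Nat.mul_le_mul_right K ht.1.le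
  have h2 := Nat.mul_le_mul_right K ht.2.1.le
  have h3 := Nat.mul_le_mul_right K ht.2.2.le
  omega

/-- Since the map does not shorten words, an image of length at most `n` comes from exponents `p, q
≤ n`. -/
theorem ncard_imageLang_starStar_le {ℓ m : ℕ} (hℓ : 1 ≤ ℓ) (hm : 1 ≤ m) (a b : Fin ℓ) (n : ℕ) :
    {w | w ∈ imageLang (mulMap ℓ m) (starStar a b) ∧ w.length ≤ n}.ncard ≤ (n + 1) ^ 2 := by
  set T : Finset (ℕ × ℕ) := Finset.range (n + 1) ×ˢ Finset.range (n + 1) with hT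
  have hcard : ((fun t : ℕ × ℕ => mulMap ℓ m (List.replicate t.1 a ++ List.replicate t.2 b)) ''
      (T : Set (ℕ × ℕ))).ncard ≤ (n + 1) ^ 2 := by
    refine (Set.ncard_image_le T.finite_toSet).trans ?_
    rw [Set.ncard_coe_finset, hT, Finset.card_product, Finset.card_range, sq]
  refine (Set.ncard_le_ncard ?_ (T.finite_toSet.image _)).trans hcard
  rintro _ ⟨⟨_, ⟨p, q, rfl⟩, rfl⟩, hw⟩
  have hlen := (length_le_length_mulMap hℓ hm _).trans hw
  simp only [List.length_append, List.length_replicate] at hlen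
  refine ⟨(p, q), ?_, rfl⟩
  simp only [hT, Finset.coe_product, Set.mem_prod, Finset.mem_coe, Finset.mem_range]
  omega

/-- If the image of `a* b*` has words in which three letters have arbitrarily long blocks, then it
is not regular: it has at most quadratic growth. -/
theorem not_isRegular_imageLang_starStar {ℓ m : ℕ} (hℓ : 1 ≤ ℓ) (hm : 1 ≤ m) (a b : Fin ℓ)
    (h : ∀ N : ℕ, ∃ (p q : ℕ) (x y z : Fin ℓ), x ≠ y ∧ x ≠ z ∧ y ≠ z ∧
      N ≤ (mulMap ℓ m (List.replicate p a ++ List.replicate q b)).count x ∧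
      N ≤ (mulMap ℓ m (List.replicate p a ++ List.replicate q b)).count y ∧
      N ≤ (mulMap ℓ m (List.replicate p a ++ List.replicate q b)).count z) :
    ¬ (imageLang (mulMap ℓ m) (starStar a b)).IsRegular := by
  intro hL
  have hnd := List.nodup_finRange ℓ
  obtain ⟨N, K, hNK⟩ := hL.exists_cube_le hnd
  obtain ⟨p, q, x, y, z, hxy, hxz, hyz, hx, hy, hz⟩ := h N
  obtain ⟨j, hj, -⟩ := exists_mulMap_eq hℓ m (List.replicate p a ++ List.replicate q b)
  have hmem : expWord (List.finRange ℓ) j ∈ imageLang (mulMap ℓ m) (starStar a b) :=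
    ⟨_, ⟨p, q, rfl⟩, hj⟩
  have hf := List.mem_finRange (n := ℓ)
  rw [hj, count_expWord hnd j (hf _)] at hx hy hz
  set S := ((List.finRange ℓ).map j).sum
  have key : ∀ n, n ^ 3 ≤ (S + 3 * (n * K) + 1) ^ 2 := fun n =>
    (hNK j x y z (hf x) (hf y) (hf z) hxy hxz hyz hx hy hz hmem n).trans
      (ncard_imageLang_starStar_le hℓ hm a b _)
  -- With `n = A² + 1` the length bound is at most `A * n`, so `n³ ≤ A²n²`, which contradicts `n >
  -- A²`.
  have h1 := key ((S + 3 * K + 1) ^ 2 + 1)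
  set A := S + 3 * K + 1 with hA
  have h2 : S + 3 * ((A ^ 2 + 1) * K) + 1 ≤ A * (A ^ 2 + 1) := by
    rw [hA]
    nlinarith [Nat.zero_le (S * A ^ 2), Nat.zero_le (A ^ 2)]
  have h3 := h1.trans (Nat.pow_le_pow_left h2 2)
  nlinarith [pow_pos (show 0 < A ^ 2 + 1 by omega) 2]

/-! ### Expansions in powers of `t = 1 / p`. -/

theorem factorial_mul_multichoose (m k : ℕ) :
    (k.factorial : ℝ) * Nat.multichoose m k = ∏ i ∈ Finset.range k, ((m : ℝ) + i) := by
  have h : k.factorial * Nat.multichoose m k = m.ascFactorial k := by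
    cases m with
    | zero => cases k <;> simp [Nat.zero_ascFactorial]
    | succ m => rw [Nat.ascFactorial_eq_factorial_mul_choose, Nat.multichoose_eq,
        show m + 1 + k - 1 = m + k by omega]
  rw [← Nat.cast_mul, h]
  clear h
  induction k with
  | zero => simp
  | succ k ih =>
    rw [Nat.ascFactorial_succ, Finset.prod_range_succ, ← ih]
    push_cast
    ring

/-- A rescaled rising factorial, see `factorial_mul_multichoose_cubic`. -/
noncomputable def scaledProd (k : ℕ) (α b s t : ℝ) : ℝ :=
  ∏ i ∈ Finset.range k, (1 + t ^ 2 * (α + (b + i * s) * t))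

theorem factorial_mul_multichoose_cubic {m p : ℕ} {β a c : ℝ} (k : ℕ) (hp : p ≠ 0) (hβ : β ≠ 0)
    (hm : (m : ℝ) = β * (p : ℝ) ^ 3 + a * p + c) :
    (k.factorial : ℝ) * Nat.multichoose m k =
      (β * (p : ℝ) ^ 3) ^ k * scaledProd k (a / β) (c / β) (1 / β) (p : ℝ)⁻¹ := by
  have hp' : (p : ℝ) ≠ 0 := Nat.cast_ne_zero.mpr hp
  rw [factorial_mul_multichoose, scaledProd, hm]
  conv_rhs => rw [← Finset.card_range k, ← Finset.prod_const, Finset.card_range,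
    ← Finset.prod_mul_distrib]
  refine Finset.prod_congr rfl fun i _ => ?_
  field_simp
  ring

/-- Induction on the number of factors. Order `t ^ 7` is needed because that is where the `p²` term
of the third digit shows. -/
theorem scaledProd_expansion (k : ℕ) (α b s : ℝ) : ∃ r : ℝ → ℝ, Continuous r ∧ ∀ t,
    scaledProd k α b s t = 1 + k * α * t ^ 2 + (k * b + s * (k * (k - 1) / 2)) * t ^ 3 +
      k * (k - 1) / 2 * α ^ 2 * t ^ 4 +
      (k - 1) * α * (k * b + s * (k * (k - 1) / 2)) * t ^ 5 +
      (k * (k - 1) / 2 * b ^ 2 + s * b * (k - 1) * (k * (k - 1) / 2) +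
        s ^ 2 * (k * (k - 1) * (k - 2) * (3 * k - 1) / 24) +
        k * (k - 1) * (k - 2) / 6 * α ^ 3) * t ^ 6 +
      (k - 1) * (k - 2) / 2 * α ^ 2 * (k * b + s * (k * (k - 1) / 2)) * t ^ 7 + t ^ 8 * r t := by
  induction k with
  | zero =>
    refine ⟨fun _ => 0, by fun_prop, fun t => ?_⟩
    simp [scaledProd]
  | succ k ih =>
    obtain ⟨r, hr, h⟩ := ih
    refine ⟨fun t => r t * (1 + t ^ 2 * (α + (b + k * s) * t)) +
      (k * (k - 1) / 2 * b ^ 2 + s * b * (k - 1) * (k * (k - 1) / 2) +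
        s ^ 2 * (k * (k - 1) * (k - 2) * (3 * k - 1) / 24) +
        k * (k - 1) * (k - 2) / 6 * α ^ 3) * (α + (b + k * s) * t) +
      (k - 1) * α * (k * b + s * (k * (k - 1) / 2)) * (b + k * s) +
      (k - 1) * (k - 2) / 2 * α ^ 2 * (k * b + s * (k * (k - 1) / 2)) * t *
        (α + (b + k * s) * t), by fun_prop, fun t => ?_⟩
    rw [scaledProd, Finset.prod_range_succ, ← scaledProd, h]
    push_cast
    ring

/-- This shorter form is for the terms with one factor fewer: they carry a prefactor `t ^ 3`, so an
error `t ^ 5` is enough. -/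
theorem scaledProd_expansion_five (k : ℕ) (α b s : ℝ) : ∃ r : ℝ → ℝ, Continuous r ∧ ∀ t,
    scaledProd k α b s t = 1 + k * α * t ^ 2 + (k * b + s * (k * (k - 1) / 2)) * t ^ 3 +
      k * (k - 1) / 2 * α ^ 2 * t ^ 4 + t ^ 5 * r t := by
  obtain ⟨r, hr, h⟩ := scaledProd_expansion k α b s
  refine ⟨fun t => (k - 1) * α * (k * b + s * (k * (k - 1) / 2)) +
      (k * (k - 1) / 2 * b ^ 2 + s * b * (k - 1) * (k * (k - 1) / 2) +
        s ^ 2 * (k * (k - 1) * (k - 2) * (3 * k - 1) / 24) +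
        k * (k - 1) * (k - 2) / 6 * α ^ 3) * t +
      (k - 1) * (k - 2) / 2 * α ^ 2 * (k * b + s * (k * (k - 1) / 2)) * t ^ 2 + t ^ 3 * r t,
    by fun_prop, fun t => ?_⟩
  rw [h]
  ring

theorem prod_range_expansion (k : ℕ) (u v s : ℝ) : ∃ r : ℝ → ℝ, Continuous r ∧ ∀ t,
    ∏ i ∈ Finset.range k, (1 + u * t + v * t ^ 2 + i * s * t ^ 3) =
      1 + k * u * t + (k * v + k * (k - 1) / 2 * u ^ 2) * t ^ 2 + t ^ 3 * r t := by
  induction k with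
  | zero => exact ⟨fun _ => 0, by fun_prop, fun t => by simp⟩
  | succ k ih =>
    obtain ⟨r, hr, h⟩ := ih
    refine ⟨fun t => r t * (1 + u * t + v * t ^ 2 + k * s * t ^ 3) + k * s +
      k * u * (v + k * s * t) + (k * v + k * (k - 1) / 2 * u ^ 2) * (u + v * t + k * s * t ^ 2),
      by fun_prop, fun t => ?_⟩
    rw [Finset.prod_range_succ, h]
    push_cast
    ring

theorem multichoose_quadratic {m p : ℕ} {β c κ : ℝ} (k : ℕ) (hp : p ≠ 0) (hβ : β ≠ 0)
    (hm : (m : ℝ) = β * (p : ℝ) ^ 3 + c * (p : ℝ) ^ 2 + κ * p) :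
    (k.factorial : ℝ) * Nat.multichoose m k =
      (β * (p : ℝ) ^ 3) ^ k * ∏ i ∈ Finset.range k, (1 + c / β * (p : ℝ)⁻¹ +
        κ / β * (p : ℝ)⁻¹ ^ 2 + i * (1 / β) * (p : ℝ)⁻¹ ^ 3) := by
  have hp' : (p : ℝ) ≠ 0 := Nat.cast_ne_zero.mpr hp
  rw [factorial_mul_multichoose, hm]
  conv_rhs => rw [← Finset.card_range k, ← Finset.prod_const, Finset.card_range,
    ← Finset.prod_mul_distrib]
  refine Finset.prod_congr rfl fun i _ => ?_
  field_simp

/-- The expansion of `β ^ ℓ val (a₁^p a_ℓ^(p³))`, for `ℓ = n + 2`, minus the first two terms of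
its combinatorial representation. -/
theorem remainder_expansion {n : ℕ} (hn : 1 ≤ n) {β d e c : ℝ} (hβ : β ≠ 0)
    (hd : d = (β - 1) * (n + 3) / 2) (he : e = (β ^ 2 - 1) * (n + 3) / 24)
    (hc : c = (β - 1) * β ^ 3 / 2) : ∃ r : ℝ → ℝ, Continuous r ∧ ∀ t,
    scaledProd (n + 2) 1 0 1 t + (n + 2) * t ^ 3 * scaledProd (n + 1) 0 1 1 t -
      (n + 2).factorial * t ^ (3 * (n + 2)) - scaledProd (n + 2) 1 (d / β) (1 / β) t -
      (n + 2) * (t ^ 3 / β) * scaledProd (n + 1) (-(β - 1)) ((d - e) / β) (1 / β) t =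
    (n + 2) * (n + 1) * (t ^ 6 / β ^ 2) * (1 + n * (-c / β) * t + t ^ 2 * r t) := by
  obtain ⟨r₁, hr₁, h₁⟩ := scaledProd_expansion (n + 2) 1 0 1
  obtain ⟨r₂, hr₂, h₂⟩ := scaledProd_expansion_five (n + 1) 0 1 1
  obtain ⟨r₃, hr₃, h₃⟩ := scaledProd_expansion (n + 2) 1 (d / β) (1 / β)
  obtain ⟨r₄, hr₄, h₄⟩ := scaledProd_expansion_five (n + 1) (-(β - 1)) ((d - e) / β) (1 / β)
  -- For `n ≥ 1` the exponent `3 * (n + 2)` is at least `9`, so the factorial term goes into the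
  -- error `t ^ 8`.
  obtain ⟨m, rfl⟩ := Nat.exists_eq_add_of_le hn
  have hm2 : ((1 + m : ℕ) : ℝ) + 2 ≠ 0 := by positivity
  have hm1 : ((1 + m : ℕ) : ℝ) + 1 ≠ 0 := by positivity
  refine ⟨fun t => β ^ 2 / (((1 + m : ℕ) + 2) * ((1 + m : ℕ) + 1)) *
    (r₁ t + ((1 + m : ℕ) + 2) * r₂ t - (1 + m + 2).factorial * t ^ (3 * m + 1) - r₃ t -
      ((1 + m : ℕ) + 2) / β * r₄ t), by fun_prop, fun t => ?_⟩
  -- The coefficient of `t ^ 3` vanishes by the choice of `d`, that of `t ^ 5` by the linear term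
  -- `-(β - 1)`; `e` makes the coefficient of `t ^ 6` the stated one, and `c` is read off at `t ^
  -- 7`.
  rw [h₁, h₂, h₃, h₄, hd, he, hc, show t ^ (3 * (1 + m + 2)) = t ^ 8 * t ^ (3 * m + 1) by ring]
  beta_reduce
  generalize ((1 + m + 2).factorial : ℝ) = F
  generalize t ^ (3 * m + 1) = w
  generalize r₁ t = y₁
  generalize r₂ t = y₂
  generalize r₃ t = y₃
  generalize r₄ t = y₄
  push_cast at hm1 hm2 ⊢
  field_simp
  ring

theorem Continuous.exists_abs_le_of_tendsto {r : ℝ → ℝ} (hr : Continuous r) :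
    ∃ C : ℝ, ∀ᶠ p : ℕ in atTop, |r (p : ℝ)⁻¹| ≤ C := by
  have h : Tendsto (fun p : ℕ => |r (p : ℝ)⁻¹|) atTop (nhds |r 0|) :=
    (hr.abs.tendsto 0).comp tendsto_inv_atTop_nhds_zero_nat
  exact ⟨|r 0| + 1, h.eventually (eventually_le_nhds (lt_add_one _))⟩

/-- The expansion at `t = 1 / p`, multiplied by `(βp³)^(n + 2)` and divided by `(n + 2)(n + 1)`; the
`- 1` is the shift in the value of `a₁^p a_ℓ^q`. -/
theorem remainder_eq {n : ℕ} (hn : 1 ≤ n) {β d e c : ℝ} (hβ : β ≠ 0)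
    (hd : d = (β - 1) * (n + 3) / 2) (he : e = (β ^ 2 - 1) * (n + 3) / 24)
    (hc : c = (β - 1) * β ^ 3 / 2) : ∃ r : ℝ → ℝ, Continuous r ∧ ∀ p M m : ℕ, p ≠ 0 →
    (M : ℝ) = β * (p : ℝ) ^ 3 + β * p + d →
    (m : ℝ) = β * (p : ℝ) ^ 3 + -(β * (β - 1)) * p + (d - e) →
    n.factorial * (β ^ (n + 2) * ((Nat.multichoose (p + p ^ 3) (n + 2) : ℝ) +
      Nat.multichoose (p ^ 3 + 1) (n + 1) - 1) - Nat.multichoose M (n + 2) -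
      Nat.multichoose m (n + 1)) =
    (β * (p : ℝ) ^ 3) ^ n * (1 + n * (-c / β) * (p : ℝ)⁻¹ + (p : ℝ)⁻¹ ^ 2 * r (p : ℝ)⁻¹) := by
  obtain ⟨r, hr, h⟩ := remainder_expansion hn hβ hd he hc
  refine ⟨r, hr, fun p M m hp hM hm => ?_⟩
  have hp' : (p : ℝ) ≠ 0 := Nat.cast_ne_zero.mpr hp
  have h1 := factorial_mul_multichoose_cubic (m := p + p ^ 3) (β := 1) (a := 1) (c := 0)
    (n + 2) hp one_ne_zero (by push_cast; ring)
  have h2 := factorial_mul_multichoose_cubic (m := p ^ 3 + 1) (β := 1) (a := 0) (c := 1)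
    (n + 1) hp one_ne_zero (by push_cast; ring)
  have h3 := factorial_mul_multichoose_cubic (n + 2) hp hβ hM
  have h4 := factorial_mul_multichoose_cubic (n + 1) hp hβ hm
  have h5 := h (p : ℝ)⁻¹
  rw [show -(β * (β - 1)) / β = -(β - 1) by field_simp] at h4
  rw [div_self hβ] at h3
  simp only [div_one, one_mul, Nat.factorial_succ] at h1 h2 h3 h4 h5
  push_cast at h1 h2 h3 h4 h5
  have hn1 : (n : ℝ) + 1 ≠ 0 := by positivity
  have hn2' : (n : ℝ) + 2 ≠ 0 := by positivity
  generalize scaledProd (n + 2) 1 0 1 (p : ℝ)⁻¹ = g1 at *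
  generalize scaledProd (n + 1) 0 1 1 (p : ℝ)⁻¹ = g2 at *
  generalize scaledProd (n + 2) 1 (d / β) (1 / β) (p : ℝ)⁻¹ = g3 at *
  generalize scaledProd (n + 1) (-(β - 1)) ((d - e) / β) (1 / β) (p : ℝ)⁻¹ = g4 at *
  have hk : ((n : ℝ) + 2) * (n + 1) ≠ 0 := mul_ne_zero hn2' hn1
  apply mul_left_cancel₀ hk
  have e1 : ((n : ℝ) + 2) * (n + 1) * ((β * (p : ℝ) ^ 3) ^ n *
      (1 + n * (-c / β) * (p : ℝ)⁻¹ + (p : ℝ)⁻¹ ^ 2 * r (p : ℝ)⁻¹)) =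
      (β * (p : ℝ) ^ 3) ^ (n + 2) * ((n + 2) * (n + 1) * ((p : ℝ)⁻¹ ^ 6 / β ^ 2) *
      (1 + n * (-c / β) * (p : ℝ)⁻¹ + (p : ℝ)⁻¹ ^ 2 * r (p : ℝ)⁻¹)) := by
    generalize (1 + n * (-c / β) * (p : ℝ)⁻¹ + (p : ℝ)⁻¹ ^ 2 * r (p : ℝ)⁻¹) = Z
    rw [pow_add _ n 2]
    field_simp
  rw [e1, ← h5]
  have x1 : (β * (p : ℝ) ^ 3) ^ (n + 2) * g1 =
      β ^ (n + 2) * (((p : ℝ) ^ 3) ^ (n + 2) * g1) := by rw [mul_pow]; ring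
  have x2 : (β * (p : ℝ) ^ 3) ^ (n + 2) * ((n + 2) * (p : ℝ)⁻¹ ^ 3 * g2) =
      β ^ (n + 2) * ((n + 2) * (((p : ℝ) ^ 3) ^ (n + 1) * g2)) := by
    rw [mul_pow, pow_succ ((p : ℝ) ^ 3) (n + 1)]
    field_simp
  have x3 : (β * (p : ℝ) ^ 3) ^ (n + 2) * (((n : ℝ) + 1 + 1) * ((n + 1) * n.factorial) *
      (p : ℝ)⁻¹ ^ (3 * (n + 2))) =
      β ^ (n + 2) * (((n : ℝ) + 1 + 1) * ((n + 1) * n.factorial)) := by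
    rw [mul_pow, ← pow_mul, inv_pow]
    field_simp
  have x4 : (β * (p : ℝ) ^ 3) ^ (n + 2) * ((n + 2) * ((p : ℝ)⁻¹ ^ 3 / β) * g4) =
      (n + 2) * ((β * (p : ℝ) ^ 3) ^ (n + 1) * g4) := by
    rw [pow_succ (β * (p : ℝ) ^ 3) (n + 1)]
    field_simp
  linear_combination β ^ (n + 2) * h1 + β ^ (n + 2) * (n + 2) * h2 - h3 - (n + 2) * h4 - x1 - x2 +
    x3 + x4

/-! ### Locating the third digit, and uniqueness of digits. -/

/-- The candidates `x` and `y` are `βp³ - cp² ∓ κp`. Their expansions agree with that of the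
remainder through order `1 / p`, and a large `κ` decides the comparison at order `1 / p²`. -/
theorem exists_bounds {n : ℕ} (hn : 1 ≤ n) {β d e c g : ℕ} (hβ : 2 ≤ β)
    (hd : (d : ℝ) = ((β : ℝ) - 1) * (n + 3) / 2) (he : (e : ℝ) = ((β : ℝ) ^ 2 - 1) * (n + 3) / 24)
    (hc : (c : ℝ) = ((β : ℝ) - 1) * (β : ℝ) ^ 3 / 2) (hg : (g : ℝ) = (β : ℝ) * (β - 1)) :
    ∃ κ : ℕ, ∀ᶠ p : ℕ in atTop, ∃ m x y R : ℕ,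
      m + (g * p + e) = β * p ^ 3 + d ∧ x + (c * p ^ 2 + κ * p) = β * p ^ 3 ∧
      y + c * p ^ 2 = β * p ^ 3 + κ * p ∧ y ≤ m ∧
      β ^ (n + 2) * (Nat.multichoose (p + p ^ 3) (n + 2) + Nat.multichoose (p ^ 3 + 1) (n + 1)) =
        Nat.multichoose (β * p ^ 3 + β * p + d) (n + 2) + Nat.multichoose m (n + 1) + R +
          β ^ (n + 2) ∧
      Nat.multichoose x n ≤ R ∧ R < Nat.multichoose y n := by
  have hβ0 : (0 : ℝ) < β := by positivity
  have hc0 : 1 ≤ c := by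
    rw [Nat.one_le_iff_ne_zero]
    rintro rfl
    have h2 : (2 : ℝ) ≤ β := by exact_mod_cast hβ
    have : 0 < ((β : ℝ) - 1) * (β : ℝ) ^ 3 / 2 := by
      have : 0 < (β : ℝ) - 1 := by linarith
      positivity
    simp only [Nat.cast_zero] at hc
    linarith
  obtain ⟨r, hr, hrem⟩ := remainder_eq hn hβ0.ne' hd he hc
  obtain ⟨C, hC⟩ := hr.exists_abs_le_of_tendsto
  set u : ℝ := -c / β with hu
  -- Besides the bound `C` for `r` and the square term, this leaves room for the cubic errors `t *
  -- r₁ t` and `t * r₂ t`, which are below `1` in absolute value once `p > D`.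
  obtain ⟨κ, hκ⟩ := exists_nat_ge ((β : ℝ) * (C + 2 + n * (n - 1) / 2 * u ^ 2))
  have hκ' : C + 2 + n * (n - 1) / 2 * u ^ 2 ≤ n * ((κ : ℝ) / β) := by
    have h1 : C + 2 + n * (n - 1) / 2 * u ^ 2 ≤ (κ : ℝ) / β := by
      rw [le_div_iff₀ hβ0]; linarith
    have h2 : (1 : ℝ) ≤ n := by exact_mod_cast hn
    have h3 : (0 : ℝ) ≤ (κ : ℝ) / β := by positivity
    nlinarith
  obtain ⟨r₁, hr₁, h₁⟩ := prod_range_expansion n u ((κ : ℝ) / β) (1 / β)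
  obtain ⟨r₂, hr₂, h₂⟩ := prod_range_expansion n u (-(κ : ℝ) / β) (1 / β)
  obtain ⟨C₁, hC₁⟩ := hr₁.exists_abs_le_of_tendsto
  obtain ⟨C₂, hC₂⟩ := hr₂.exists_abs_le_of_tendsto
  obtain ⟨D, hD⟩ := exists_nat_ge (max C₁ C₂)
  refine ⟨κ, ?_⟩
  filter_upwards [hC, hC₁, hC₂, eventually_ge_atTop (D + 1), eventually_ge_atTop (c + κ + g + e + 1)]
    with p hCp hC₁p hC₂p hDp hp
  have hp1 : p ≠ 0 := by omega
  have hp0 : (0 : ℝ) < p := by positivity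
  have q1 : p ≤ p ^ 2 := Nat.le_self_pow two_ne_zero p
  have q2 : (c + κ + g + e + 1) * p ≤ p ^ 2 := by rw [sq]; exact Nat.mul_le_mul_right p hp
  have q3 : (c + κ + g + e + 1) * p ^ 2 ≤ p ^ 3 := by
    rw [pow_succ' p 2]; exact Nat.mul_le_mul_right _ hp
  have q4 : p ^ 3 ≤ β * p ^ 3 := Nat.le_mul_of_pos_left _ (by omega)
  have q5 : p ^ 2 ≤ c * p ^ 2 := Nat.le_mul_of_pos_left _ hc0
  have q6 : g * p + κ * p + e ≤ p ^ 2 := by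
    have := Nat.le_mul_of_pos_right e (show 0 < p by omega)
    simp only [add_mul] at q2
    omega
  have q7 : c * p ^ 2 + κ * p + g * p + e ≤ p ^ 3 := by
    have h1 := Nat.mul_le_mul_left κ q1
    have h2 := Nat.mul_le_mul_left g q1
    have h3 := Nat.le_mul_of_pos_right e (pow_pos (show 0 < p by omega) 2)
    simp only [add_mul, one_mul] at q3
    omega
  obtain ⟨m, hm⟩ := Nat.exists_eq_add_of_le (show g * p + e ≤ β * p ^ 3 + d by omega)
  obtain ⟨x, hx⟩ := Nat.exists_eq_add_of_le (show c * p ^ 2 + κ * p ≤ β * p ^ 3 by omega)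
  obtain ⟨y, hy⟩ := Nat.exists_eq_add_of_le (show c * p ^ 2 ≤ β * p ^ 3 + κ * p by omega)
  have hmR : (m : ℝ) = β * (p : ℝ) ^ 3 + -((β : ℝ) * (β - 1)) * p + (d - e) := by
    have : (β : ℝ) * (p : ℝ) ^ 3 + d = g * p + e + m := by exact_mod_cast hm
    rw [← hg]; linarith
  have hxR : (x : ℝ) = β * (p : ℝ) ^ 3 + -(c : ℝ) * (p : ℝ) ^ 2 + -(κ : ℝ) * p := by
    have : (β : ℝ) * (p : ℝ) ^ 3 = c * (p : ℝ) ^ 2 + κ * p + x := by exact_mod_cast hx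
    linarith
  have hyR : (y : ℝ) = β * (p : ℝ) ^ 3 + -(c : ℝ) * (p : ℝ) ^ 2 + κ * p := by
    have : (β : ℝ) * (p : ℝ) ^ 3 + κ * p = c * (p : ℝ) ^ 2 + y := by exact_mod_cast hy
    linarith
  have hX := multichoose_quadratic n hp1 hβ0.ne' hxR
  have hY := multichoose_quadratic n hp1 hβ0.ne' hyR
  have hR := hrem p (β * p ^ 3 + β * p + d) m hp1 (by push_cast; ring) hmR
  rw [← hu, h₁] at hY
  rw [← hu, h₂] at hX
  set t : ℝ := (p : ℝ)⁻¹ with ht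
  have ht0 : 0 < t := inv_pos.mpr hp0
  have htD : t * (D : ℝ) < 1 := by
    have : (D : ℝ) + 1 ≤ p := by exact_mod_cast hDp
    rw [ht, inv_mul_lt_iff₀ hp0]
    linarith
  have b1 : -1 < t * r₁ t := by
    have : |t * r₁ t| < 1 := by
      rw [abs_mul, abs_of_pos ht0]
      exact lt_of_le_of_lt (mul_le_mul_of_nonneg_left
        (hC₁p.trans ((le_max_left _ _).trans hD)) ht0.le) htD
    exact (abs_lt.mp this).1
  have b2 : t * r₂ t < 1 := by
    have : |t * r₂ t| < 1 := by
      rw [abs_mul, abs_of_pos ht0]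
      exact lt_of_le_of_lt (mul_le_mul_of_nonneg_left
        (hC₂p.trans ((le_max_right _ _).trans hD)) ht0.le) htD
    exact (abs_lt.mp this).2
  obtain ⟨b3, b4⟩ := abs_le.mp hCp
  have hpos : (0 : ℝ) < (β * (p : ℝ) ^ 3) ^ n := by positivity
  have hfac : (0 : ℝ) < n.factorial := by exact_mod_cast n.factorial_pos
  set Q : ℝ := (β : ℝ) ^ (n + 2) * ((Nat.multichoose (p + p ^ 3) (n + 2) : ℝ) +
      Nat.multichoose (p ^ 3 + 1) (n + 1) - 1) - Nat.multichoose (β * p ^ 3 + β * p + d) (n + 2) -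
      Nat.multichoose m (n + 1) with hQ
  have ht2 : 0 < t ^ 2 := by positivity
  have hup : Q < Nat.multichoose y n := by
    refine lt_of_mul_lt_mul_left ?_ hfac.le
    rw [hR, hY]
    refine mul_lt_mul_of_pos_left ?_ hpos
    have hnn : (0 : ℝ) ≤ n * (n - 1) / 2 * u ^ 2 := by
      have : (1 : ℝ) ≤ n := by exact_mod_cast hn
      have : (0 : ℝ) ≤ (n : ℝ) - 1 := by linarith
      positivity
    have hcoef : 0 < n * ((κ : ℝ) / β) + n * (n - 1) / 2 * u ^ 2 + t * r₁ t - r t := by linarith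
    refine sub_pos.mp ((mul_pos ht2 hcoef).trans_eq ?_)
    ring
  have hlow : (Nat.multichoose x n : ℝ) ≤ Q := by
    refine le_of_mul_le_mul_left ?_ hfac
    rw [hR, hX]
    refine mul_le_mul_of_nonneg_left ?_ hpos.le
    have hcoef : 0 ≤ r t - (n * (-(κ : ℝ) / β) + n * (n - 1) / 2 * u ^ 2 + t * r₂ t) := by
      rw [neg_div]
      linarith
    refine sub_nonneg.mp ((mul_nonneg ht2.le hcoef).trans_eq ?_)
    ring
  have hle : Nat.multichoose (β * p ^ 3 + β * p + d) (n + 2) + Nat.multichoose m (n + 1) +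
      Nat.multichoose x n + β ^ (n + 2) ≤
      β ^ (n + 2) * (Nat.multichoose (p + p ^ 3) (n + 2) + Nat.multichoose (p ^ 3 + 1) (n + 1)) := by
    rw [hQ] at hlow
    have : ((Nat.multichoose (β * p ^ 3 + β * p + d) (n + 2) + Nat.multichoose m (n + 1) +
      Nat.multichoose x n + β ^ (n + 2) : ℕ) : ℝ) ≤ ((β ^ (n + 2) *
      (Nat.multichoose (p + p ^ 3) (n + 2) + Nat.multichoose (p ^ 3 + 1) (n + 1)) : ℕ) : ℝ) := by
      push_cast
      linarith
    exact_mod_cast this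
  obtain ⟨R', hR'⟩ := Nat.exists_eq_add_of_le hle
  refine ⟨m, x, y, Nat.multichoose x n + R', by omega, by omega, by omega, by omega, by omega,
    by omega, ?_⟩
  have : ((Nat.multichoose x n + R' : ℕ) : ℝ) = Q := by
    have h := congrArg (Nat.cast (R := ℝ)) hR'
    push_cast at h ⊢
    rw [hQ]
    linarith
  rw [← this] at hup
  exact_mod_cast hup

/-- When the digits decrease weakly, everything after a digit is smaller than the gap to its
successor, so each digit is the largest possible. The third is only bracketed, by monotonicity. -/
theorem multichoose_unique {n M M' m m' z x y R r : ℕ} (hm : m ≤ M) (hy : y ≤ m)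
    (hm' : m' ≤ M') (hz : z ≤ m')
    (h : Nat.multichoose M' (n + 2) + Nat.multichoose m' (n + 1) + r =
      Nat.multichoose M (n + 2) + Nat.multichoose m (n + 1) + R)
    (hx : Nat.multichoose x n ≤ R) (hRy : R < Nat.multichoose y n)
    (hzr : Nat.multichoose z n ≤ r) (hrz : r < Nat.multichoose (z + 1) n) :
    M' = M ∧ m' = m ∧ x ≤ z ∧ z < y := by
  have mono := fun k => @multichoose_mono k
  have succ2 : ∀ k, Nat.multichoose (k + 1) (n + 2) =
    Nat.multichoose k (n + 2) + Nat.multichoose (k + 1) (n + 1) :=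
      fun k => Nat.multichoose_succ_succ k (n + 1)
  have h1 : Nat.multichoose m (n + 1) + R < Nat.multichoose (M + 1) (n + 1) := by
    refine lt_of_lt_of_le ?_ (mono (n + 1) (show m + 1 ≤ M + 1 by omega))
    have := mono n (show y ≤ m + 1 by omega)
    simp only [Nat.multichoose_succ_succ] at this ⊢
    omega
  have h1' : Nat.multichoose m' (n + 1) + r < Nat.multichoose (M' + 1) (n + 1) := by
    refine lt_of_lt_of_le ?_ (mono (n + 1) (show m' + 1 ≤ M' + 1 by omega))
    have := mono n (show z + 1 ≤ m' + 1 by omega)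
    simp only [Nat.multichoose_succ_succ] at this ⊢
    omega
  have hM : M' = M := by
    rcases lt_trichotomy M' M with hlt | heq | hlt
    · have := mono (n + 2) (show M' + 1 ≤ M by omega)
      simp only [succ2] at this
      omega
    · exact heq
    · have := mono (n + 2) (show M + 1 ≤ M' by omega)
      simp only [succ2] at this
      omega
  subst hM
  have hmm : m' = m := by
    rcases lt_trichotomy m' m with hlt | heq | hlt
    · have h2 := mono (n + 1) (show m' + 1 ≤ m by omega)
      have h3 := mono n (show z + 1 ≤ m' + 1 by omega)
      simp only [Nat.multichoose_succ_succ m' n] at h2 h3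
      omega
    · exact heq
    · have h2 := mono (n + 1) (show m + 1 ≤ m' by omega)
      have h3 := mono n (show y ≤ m + 1 by omega)
      simp only [Nat.multichoose_succ_succ m n] at h2 h3
      omega
  subst hmm
  have hrR : r = R := by omega
  subst hrR
  refine ⟨rfl, rfl, ?_, ?_⟩
  · by_contra! hlt
    have := mono n (show z + 1 ≤ x by omega)
    simp only at this
    omega
  · by_contra! hlt
    have := mono n hlt
    simp only at this
    omega

/-! ### The exponents of the image word and the conclusion. -/

theorem sum_filter_two_le_count {n : ℕ} (j : Fin (n + 2) → ℕ) :
    ∑ i ∈ Finset.univ.filter (fun i : Fin (n + 2) => 2 ≤ (i : ℕ)),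
      (expWord (List.finRange (n + 2)) j).count i = ∑ i : Fin n, j i.succ.succ := by
  have h : ∀ i, (expWord (List.finRange (n + 2)) j).count i = j i := fun i =>
    count_expWord (List.nodup_finRange _) j (List.mem_finRange i)
  simp only [h]
  rw [Finset.sum_filter, Fin.sum_univ_succ, Fin.sum_univ_succ]
  simp

theorem exists_nat_eq_of_rat_eq_int {x : ℚ} (hx : 0 ≤ x) (h : ∃ k : ℤ, x = k) :
    ∃ k : ℕ, (k : ℚ) = x := by
  obtain ⟨k, rfl⟩ := h
  exact ⟨k.toNat, by exact_mod_cast Int.toNat_of_nonneg (by exact_mod_cast hx)⟩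

/-- The exponents of `f_{β ^ ℓ} (a₁^p a_ℓ^(p³))`, for `ℓ = n + 2`. -/
theorem exists_exponents {n : ℕ} (hn : 1 ≤ n) {β d e c g : ℕ} (hβ : 2 ≤ β)
    (hd : (d : ℝ) = ((β : ℝ) - 1) * (n + 3) / 2) (he : (e : ℝ) = ((β : ℝ) ^ 2 - 1) * (n + 3) / 24)
    (hc : 2 * c = β * (β - 1) * β ^ 2) (hg : g = β * (β - 1)) :
    ∃ κ : ℕ, ∀ᶠ p : ℕ in atTop, ∃ j : Fin (n + 2) → ℕ,
      mulMap (n + 2) (β ^ (n + 2))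
        (List.replicate p 0 ++ List.replicate (p ^ 3) (Fin.last (n + 1))) =
          expWord (List.finRange (n + 2)) j ∧
      j 0 = β ^ 2 * p + e ∧
      j 1 ≤ c * p ^ 2 + κ * p + d ∧ c * p ^ 2 ≤ j 1 + κ * p + g * p + e ∧
      ∑ i : Fin n, j i.succ.succ ≤ β * p ^ 3 + κ * p ∧
      β * p ^ 3 ≤ (∑ i : Fin n, j i.succ.succ) + c * p ^ 2 + κ * p := by
  have hβ1 : ((β - 1 : ℕ) : ℝ) = β - 1 := by rw [Nat.cast_sub (by omega), Nat.cast_one]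
  have hcR : (c : ℝ) = ((β : ℝ) - 1) * (β : ℝ) ^ 3 / 2 := by
    have := congrArg (Nat.cast (R := ℝ)) hc
    push_cast [hβ1] at this
    linear_combination this / 2
  have hgR : (g : ℝ) = (β : ℝ) * (β - 1) := by rw [hg]; push_cast [hβ1]; ring
  have hgβ : g + β = β ^ 2 := by
    obtain ⟨b, rfl⟩ := Nat.exists_eq_add_of_le' (show 1 ≤ β by omega)
    rw [hg, Nat.add_sub_cancel]
    ring
  obtain ⟨κ, hκ⟩ := exists_bounds hn hβ hd he hcR hgR
  refine ⟨κ, ?_⟩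
  filter_upwards [hκ] with p ⟨m, x, y, R, hm, hx, hy, hym, hval, hxR, hRy⟩
  obtain ⟨j, hj, hjval⟩ := exists_mulMap_eq (by omega) (β ^ (n + 2))
    (List.replicate p 0 ++ List.replicate (p ^ 3) (Fin.last (n + 1)))
  obtain ⟨i, hi, hival⟩ := exists_expWord_eq_starStar n p (p ^ 3)
  rw [hi, valB_expWord] at hjval
  change _ = β ^ (n + 2) * expVal (List.finRange (n + 2)) i at hjval
  rw [← hival] at hval
  set rest : List (Fin (n + 2)) := ((List.finRange n).map Fin.succ).map Fin.succ with hrest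
  have hfin : List.finRange (n + 2) = 0 :: 1 :: rest := by
    rw [List.finRange_succ, List.finRange_succ]
    simp [hrest]
  have hlen : rest.length = n := by simp [hrest]
  have hsum : (rest.map j).sum = ∑ i : Fin n, j i.succ.succ := by
    rw [hrest, Fin.sum_univ_def]
    simp [Function.comp_def]
  have hne : rest ≠ [] := by
    rw [← List.length_pos_iff]
    omega
  have h1 := expVal_lt rest j
  have h2 := le_expVal rest j hne
  rw [hlen, hsum] at h1 h2
  have h3 : expVal (List.finRange (n + 2)) j =
      Nat.multichoose (j 0 + (j 1 + ∑ i : Fin n, j i.succ.succ)) (n + 2) +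
        (Nat.multichoose (j 1 + ∑ i : Fin n, j i.succ.succ) (n + 1) + expVal rest j) := by
    rw [hfin]
    simp [expVal, hsum, hlen]
  rw [h3] at hjval
  refine ⟨j, hj, ?_⟩
  set z := ∑ i : Fin n, j i.succ.succ
  rw [mul_add, mul_one] at hval
  -- The suffix lengths of the image word are compared with the computed digits. Subtracting, `j 0`
  -- is `βp + gp + e`, which is `β²p + e` because `g + β = β²`.
  obtain ⟨u1, u2, u3, u4⟩ := multichoose_unique (M := β * p ^ 3 + β * p + d)
    (M' := j 0 + (j 1 + z)) (m' := j 1 + z) (r := expVal rest j) (R := R)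
    (by omega) hym (Nat.le_add_left _ _) (Nat.le_add_left _ _) (by omega) hxR hRy h2 h1
  have hgp : g * p + β * p = β ^ 2 * p := by rw [← add_mul, hgβ]
  exact ⟨by omega, by omega, by omega, by omega, by omega⟩

theorem isBigO_of_abs_le_mul {f g : ℕ → ℝ} (C : ℝ) (h : ∀ᶠ p in atTop, |f p| ≤ C * g p)
    (hg : ∀ p, 0 ≤ g p) : f =O[atTop] g := by
  refine IsBigO.of_bound C (h.mono fun p hp => ?_)
  rwa [Real.norm_eq_abs, Real.norm_eq_abs, abs_of_nonneg (hg p)]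

theorem mainTheorem3 (ℓ β : ℕ) (hℓ : 3 ≤ ℓ) (hβ : 2 ≤ β)
    (h₁ : ∃ k : ℤ, ((β : ℚ) - 1) * ((ℓ : ℚ) + 1) / 2 = k)
    (h₂ : ∃ k : ℤ, ((β : ℚ) ^ 2 - 1) * ((ℓ : ℚ) + 1) / 24 = k)
    -- the letters with (zero-based) indices `0`, `1` and `ℓ - 1`
    (a₁ a₂ aₗ : Fin ℓ) (ha₁ : (a₁ : ℕ) = 0) (ha₂ : (a₂ : ℕ) = 1) (haₗ : (aₗ : ℕ) + 1 = ℓ) :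
    ¬ (imageLang (mulMap ℓ (β ^ ℓ)) (starStar a₁ aₗ)).IsRegular ∧
    (fun p : ℕ =>
        ((mulMap ℓ (β ^ ℓ) (List.replicate p a₁ ++ List.replicate (p ^ 3) aₗ)).count a₁ : ℝ)
          - (β : ℝ) ^ 2 * (p : ℝ))
      =O[atTop] (fun _ : ℕ => (1 : ℝ)) ∧
    (fun p : ℕ =>
        ((mulMap ℓ (β ^ ℓ) (List.replicate p a₁ ++ List.replicate (p ^ 3) aₗ)).count a₂ : ℝ)
          - ((β : ℝ) - 1) * (β : ℝ) ^ 3 / 2 * (p : ℝ) ^ 2)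
      =O[atTop] (fun p : ℕ => (p : ℝ)) ∧
    (fun p : ℕ =>
        (∑ j ∈ Finset.univ.filter (fun j : Fin ℓ => 2 ≤ (j : ℕ)),
          ((mulMap ℓ (β ^ ℓ) (List.replicate p a₁ ++ List.replicate (p ^ 3) aₗ)).count j : ℝ))
          - (β : ℝ) * (p : ℝ) ^ 3)
      =O[atTop] (fun p : ℕ => (p : ℝ) ^ 2) := by
  obtain ⟨n, rfl⟩ := Nat.exists_eq_add_of_le' (show 2 ≤ ℓ by omega)
  have hn : 1 ≤ n := by omega
  obtain rfl : a₁ = 0 := Fin.ext (by simpa using ha₁)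
  obtain rfl : a₂ = 1 := Fin.ext (by simpa using ha₂)
  obtain rfl : aₗ = Fin.last (n + 1) := Fin.ext (by simp; omega)
  have hβQ : (2 : ℚ) ≤ β := by exact_mod_cast hβ
  have hβ1 : (0 : ℚ) ≤ (β : ℚ) - 1 := by linarith
  have hβ2 : (0 : ℚ) ≤ (β : ℚ) ^ 2 - 1 := by nlinarith
  obtain ⟨d, hd⟩ := exists_nat_eq_of_rat_eq_int (by positivity) h₁
  obtain ⟨e, he⟩ := exists_nat_eq_of_rat_eq_int (by positivity) h₂
  have hdR : (d : ℝ) = ((β : ℝ) - 1) * (n + 3) / 2 := by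
    have := congrArg (Rat.cast (K := ℝ)) hd
    push_cast at this
    rw [this]; ring
  have heR : (e : ℝ) = ((β : ℝ) ^ 2 - 1) * (n + 3) / 24 := by
    have := congrArg (Rat.cast (K := ℝ)) he
    push_cast at this
    rw [this]; ring
  obtain ⟨c, hc⟩ : ∃ c, 2 * c = β * (β - 1) * β ^ 2 := by
    obtain ⟨k, hk⟩ := (Nat.even_mul_pred_self β).two_dvd
    exact ⟨k * β ^ 2, by rw [hk]; ring⟩
  have hcR : ((β : ℝ) - 1) * (β : ℝ) ^ 3 / 2 = c := by
    have := congrArg (Nat.cast (R := ℝ)) hc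
    push_cast [Nat.cast_sub (show 1 ≤ β by omega)] at this
    linear_combination - this / 2
  have hc0 : 1 ≤ c := by
    have : 0 < β * (β - 1) * β ^ 2 := by
      have : 0 < β - 1 := by omega
      positivity
    omega
  obtain ⟨κ, hκ⟩ := exists_exponents hn hβ hdR heR hc rfl
  set g := β * (β - 1) with hg
  have hcount : ∀ (j : Fin (n + 2) → ℕ) i, (expWord (List.finRange (n + 2)) j).count i = j i :=
    fun j i => count_expWord (List.nodup_finRange _) j (List.mem_finRange i)
  refine ⟨?_, ?_, ?_, ?_⟩
  · refine not_isRegular_imageLang_starStar (by omega) (Nat.one_le_pow _ _ (by omega)) _ _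
      fun N => ?_
    obtain ⟨p, ⟨j, hj, h0, -, h1, -, h2⟩, hp⟩ :=
      (hκ.and (eventually_ge_atTop (N + n + c + κ + g + e + 1))).exists
    have hp0 : 0 < p := by omega
    have hsq : (N + n + c + κ + g + e + 1) * p ≤ p ^ 2 := by
      rw [sq]; exact Nat.mul_le_mul_right p hp
    have hcube : (N + n + c + κ + g + e + 1) * p ^ 2 ≤ p ^ 3 := by
      rw [pow_succ' p 2]; exact Nat.mul_le_mul_right _ hp
    simp only [add_mul, one_mul] at hsq hcube
    have hNp := Nat.le_mul_of_pos_right N hp0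
    have hep := Nat.le_mul_of_pos_right e hp0
    have hcp : p ^ 2 ≤ c * p ^ 2 := Nat.le_mul_of_pos_left _ hc0
    have hβp : p ≤ β ^ 2 * p := Nat.le_mul_of_pos_left _ (by positivity)
    have hβp3 : p ^ 3 ≤ β * p ^ 3 := Nat.le_mul_of_pos_left _ (by omega)
    have hκp := Nat.mul_le_mul_left κ (Nat.le_self_pow two_ne_zero p)
    have hnN : n * N ≤ n * p ^ 2 :=
      Nat.mul_le_mul_left n ((show N ≤ p by omega).trans (Nat.le_self_pow two_ne_zero p))
    have hp2 : 0 < p ^ 2 := by positivity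
    -- Pigeonhole: the last `n` exponents sum to more than `n * N`, so one of them is a third long
    -- block.
    obtain ⟨i, hi⟩ : ∃ i : Fin n, N ≤ j i.succ.succ := by
      by_contra! hlt
      have : ∑ i : Fin n, j i.succ.succ ≤ n * N := by
        refine (Finset.sum_le_card_nsmul _ _ N fun i _ => (hlt i).le).trans_eq ?_
        simp
      omega
    refine ⟨p, p ^ 3, 0, 1, i.succ.succ, by simp, (Fin.succ_ne_zero _).symm, ?_, ?_⟩
    · simp [Fin.ext_iff]
    · rw [hj, hcount, hcount, hcount]
      exact ⟨by omega, by omega, hi⟩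
  · refine isBigO_of_abs_le_mul e (hκ.mono ?_) fun _ => zero_le_one
    rintro p ⟨j, hj, h0, -⟩
    rw [hj, hcount, h0]
    push_cast
    rw [add_sub_cancel_left, abs_of_nonneg (Nat.cast_nonneg _), mul_one]
  · refine isBigO_of_abs_le_mul (κ + g + d + e) ((hκ.and (eventually_ge_atTop 1)).mono ?_)
      fun _ => Nat.cast_nonneg _
    rintro p ⟨⟨j, hj, -, h1, h2, -⟩, hp⟩
    rw [hj, hcount, hcR]
    have hpR : (1 : ℝ) ≤ p := by exact_mod_cast hp
    have h1R : (j 1 : ℝ) ≤ c * (p : ℝ) ^ 2 + κ * p + d := by exact_mod_cast h1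
    have h2R : c * (p : ℝ) ^ 2 ≤ j 1 + κ * p + g * p + e := by exact_mod_cast h2
    have hdp : (d : ℝ) ≤ d * p := le_mul_of_one_le_right (Nat.cast_nonneg _) hpR
    have hep : (e : ℝ) ≤ e * p := le_mul_of_one_le_right (Nat.cast_nonneg _) hpR
    have hgp : (0 : ℝ) ≤ g * p := by positivity
    rw [abs_le]
    constructor <;> nlinarith [Nat.cast_nonneg (α := ℝ) d, Nat.cast_nonneg (α := ℝ) e]
  · refine isBigO_of_abs_le_mul (c + κ) ((hκ.and (eventually_ge_atTop 1)).mono ?_)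
      fun _ => by positivity
    rintro p ⟨⟨j, hj, -, -, -, h1, h2⟩, hp⟩
    rw [hj, ← Nat.cast_sum, sum_filter_two_le_count]
    have hpR : (p : ℝ) ≤ (p : ℝ) ^ 2 := by exact_mod_cast Nat.le_self_pow two_ne_zero p
    have h1R : ((∑ i : Fin n, j i.succ.succ : ℕ) : ℝ) ≤ β * (p : ℝ) ^ 3 + κ * p := by
      exact_mod_cast h1
    have h2R : β * (p : ℝ) ^ 3 ≤
        ((∑ i : Fin n, j i.succ.succ : ℕ) : ℝ) + c * (p : ℝ) ^ 2 + κ * p := by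
      exact_mod_cast h2
    have hκp : (κ : ℝ) * p ≤ κ * (p : ℝ) ^ 2 := mul_le_mul_of_nonneg_left hpR (Nat.cast_nonneg _)
    have hcp : (0 : ℝ) ≤ c * (p : ℝ) ^ 2 := by positivity
    rw [abs_le, add_mul]
    constructor <;> linarith
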